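/- Let $P=\{(\xi,\eta)\in\mathbb R^2\mid \xi\ge 0,\ \eta\ge 0\}\setminus\{(0,0)\}$, let $\Phi^t(\xi,\eta)=(e^t\xi,e^{-t}\eta)$ be the standard Reeb flow on $P$, and call a continuous flow $\{\phi^t\}_{t\in\mathbb R}$ on $P$ an $\mathcal R$-flow if it has the same orbits, with the same orientation, as $\{\Phi^t\}$. Two flows $\{\phi^t\},\{\psi^t\}$ on $P$ are topologically conjugate if there is a homeomorphism $h$ of $P$ with $h\circ\phi^t=\psi^t\circ h$ for all $t\in\mathbb R$. Let $E$ be the set of continuous functions $f:(0,\infty)\to\mathbb R$ with $\lim_{x\to0}f(x)=\infty$, and for $f\in E$ put $$\sigma(f)=\limsup_{x\to0}\Bigl(\max_{[x,1]}f-f(x)\Bigr)\in[0,\infty].$$ The function $f(x)=\frac1x\,2^{\sin(2\pi\log_2x)}$ belongs to $E$ and satisfies $f(x/2)=2f(x)$ for all $x>0$ and $\sigma(f)=\infty$. Moreover there is an $\mathcal R$-flow $\{\phi^t\}$ such that: 1. there are continuous paths $\gamma_1,\gamma_2:[0,\infty)\to P$ with $\gamma_1(0)\in\{\xi=0\}$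 and $\gamma_2(0)\in\{\eta=0\}$, each lying in $\{\xi>0,\eta>0\}$ for positive parameters and meeting every orbit in $\{\xi>0,\eta>0\}$ exactly once, such that for every $x>0$ the number $f(x)$ is the unique time $t\in\mathbb R$ with $\phi^t(\gamma_1(x))\in\gamma_2([0,\infty))$; 2. $\{\phi^t\}$ is not topologically conjugate to the standard Reeb flow $\{\Phi^t\}$; 3. $\{\phi^{2t}\}$ is topologically conjugate to $\{\phi^t\}$. In particular, conjugacy of $\{\phi^{\lambda t}\}$ to $\{\phi^t\}$ for the single value $\lambda=2$ does not imply that $\{\phi^t\}$ is conjugate to the standard Reeb flow. -/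

import Mathlib

open Filter Topology Set
open scoped NNReal

/-- The closed quarter plane without its corner,
`P = {(ξ, η) | ξ ≥ 0, η ≥ 0} - {(0, 0)}`, with the subspace topology. -/
abbrev ReebPlane : Type :=
  {p : ℝ × ℝ // 0 ≤ p.1 ∧ 0 ≤ p.2 ∧ p ≠ (0, 0)}

namespace ReebPlane

/-- The boundary leaf `{ξ = 0}`. -/
def xiZero : Set ReebPlane := {p | p.1.1 = 0}

/-- The boundary leaf `{η = 0}`. -/
def etaZero : Set ReebPlane := {p | p.1.2 = 0}

/-- The union of the interior leaves, `{ξ > 0, η > 0}`. -/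
def inner : Set ReebPlane := {p | 0 < p.1.1 ∧ 0 < p.1.2}

end ReebPlane

/-- The standard Reeb flow `Φ^t (ξ, η) = (e^t ξ, e^{-t} η)` on `P`. -/
noncomputable def standardReebFlow : Flow ℝ ReebPlane where
  toFun t p := ⟨(Real.exp t * p.1.1, Real.exp (-t) * p.1.2), by
    obtain ⟨⟨a, b⟩, ha, hb, hab⟩ := p
    refine ⟨mul_nonneg (Real.exp_pos _).le ha, mul_nonneg (Real.exp_pos _).le hb, ?_⟩
    intro h
    apply hab
    simpa [Prod.ext_iff, Real.exp_ne_zero] using h⟩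
  cont' := by
    unfold Function.uncurry
    fun_prop
  map_add' t₁ t₂ p := by
    apply Subtype.ext
    simp only [Prod.mk.injEq, neg_add, Real.exp_add]
    constructor <;> ring
  map_zero' p := by
    apply Subtype.ext
    simp

/-- An `ℛ`-flow: a continuous flow on `P` whose oriented orbit foliation is the Reeb foliation, that
is, which has the same orbits as the standard Reeb flow, run through in the same direction. -/
structure IsReebFlow (φ : Flow ℝ ReebPlane) : Prop where
  orbit_eq : ∀ p, φ.orbit p = standardReebFlow.orbit p
  oriented : ∀ p t, 0 < t → ∃ s, 0 < s ∧ φ t p = standardReebFlow s p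

/-- The flow `{φ^{c t}}` obtained from `{φ^t}` by multiplying time by the constant `c`. -/
def Flow.rescale {X : Type*} [TopologicalSpace X] (φ : Flow ℝ X) (c : ℝ) : Flow ℝ X where
  toFun t x := φ (c * t) x
  cont' := by
    unfold Function.uncurry
    fun_prop
  map_add' t₁ t₂ x := by rw [mul_add, φ.map_add]
  map_zero' x := by rw [mul_zero, φ.map_zero_apply]

/-- Topological conjugacy of flows: a homeomorphism `h` with `h ∘ φ^t = ψ^t ∘ h` for all `t`. -/
def Flow.IsConjugate {X Y : Type*} [TopologicalSpace X] [TopologicalSpace Y]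
    (φ : Flow ℝ X) (ψ : Flow ℝ Y) : Prop :=
  ∃ h : X ≃ₜ Y, Flow.IsSemiconjugacy h φ ψ

/-- A continuous path `γ : [0, ∞) → P` that starts at a point of `B`, lies in the interior of `P`
for positive parameters, and meets every interior leaf exactly once. -/
structure IsReebTransversal (B : Set ReebPlane) (γ : ℝ≥0 → ReebPlane) : Prop where
  continuous : Continuous γ
  start : γ 0 ∈ B
  mem_inner : ∀ x, 0 < x → γ x ∈ ReebPlane.inner
  meets : ∀ p ∈ ReebPlane.inner, ∃! x, γ x ∈ standardReebFlow.orbit p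

/-- `f` is, on `(0, ∞)`, the function `f_{φ, γ₁, γ₂}`: for `x > 0`, the number `f x` is the time
(the only one) that the flow `φ` needs to move from `γ₁ x` to a point of the curve `γ₂`. -/
def IsTransitTime (φ : Flow ℝ ReebPlane) (γ₁ γ₂ : ℝ≥0 → ReebPlane) (f : ℝ → ℝ) : Prop :=
  ∀ x : ℝ≥0, 0 < x → ∀ t : ℝ, φ t (γ₁ x) ∈ range γ₂ ↔ t = f x

/-- The space `E` of continuous functions on `(0, ∞)` that tend to `∞` at `0`. Only the
restriction of `f` to `(0, ∞)` matters. -/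
def reebE : Set (ℝ → ℝ) :=
  {f | ContinuousOn f (Ioi 0) ∧ Tendsto f (𝓝[>] 0) atTop}

/-- `f^*(x) = max (f |_[x, 1]) - f x`, for `0 < x ≤ 1`. -/
noncomputable def reebStar (f : ℝ → ℝ) (x : ℝ) : ℝ :=
  sSup (f '' Icc x 1) - f x

/-- `σ(f) = limsup_{x → 0} f^*(x)`, the upper limit being taken in the extended reals, over `x > 0`. -/
noncomputable def reebSigma (f : ℝ → ℝ) : EReal :=
  limsup (fun x : ℝ => (reebStar f x : EReal)) (𝓝[>] 0)

/-- The function `f(x) = x⁻¹ 2^{sin (2π log₂ x)}`. -/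
noncomputable def reebExample (x : ℝ) : ℝ :=
  x⁻¹ * (2 : ℝ) ^ Real.sin (2 * Real.pi * Real.logb 2 x)

/-!
Every `f ∈ E` is the transit time of an `ℛ`-flow: the flow is translation of time in two flow
boxes `[0, ∞) × ℝ`, one around each boundary leaf, glued along the interior leaves by
`(x, t) ↦ (x, t - f x)`. Since `f` tends to `∞` at `0`, time on the leaf `ξ η = x` can be
converted to that of the standard Reeb flow by a map that is a mere translation near either end of
the crossing, on periods whose lengths tend to `∞` as `x → 0`; this identifies the glued space with
`P`. If `f (x / l) = c f x`, then the map `(x, t) ↦ (l x, t / c)` of both boxes respects the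
gluing, so `{φ^{c t}}` is conjugate to `{φ^t}`.

Conversely, let `h` conjugate an `ℛ`-flow with transit time `f` to the standard Reeb flow, which
moves a point near `{ξ = 0}` on the leaf `ξ η = y` to a point near `{η = 0}` in time
`-log y + O(1)`. Then `f x + log y(x)` converges as `x → 0`, where `y(x)` is the leaf
of `h (γ₁ x)`, and `y` increases with `x`. So the increases of `f` near `0` are arbitrarily small,
that is `σ(f) ≤ 0`. When `f (x / 2) = 2 f x`, any increase of `f` is doubled by halving `x`, which
makes `σ(f) = ∞`.
-/

theorem IsReebFlow.of_timeChange {φ : Flow ℝ ReebPlane}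
    (h : ∀ p, ∃ θ : ℝ → ℝ, StrictMono θ ∧ Function.Surjective θ ∧ θ 0 = 0 ∧
      ∀ t, φ t p = standardReebFlow (θ t) p) :
    IsReebFlow φ where
  orbit_eq p := by
    obtain ⟨θ, -, h_surj, -, hθ⟩ := h p
    ext q
    simp only [Flow.mem_orbit_iff, hθ]
    exact (h_surj.exists (p := fun s => standardReebFlow s p = q)).symm
  oriented p t ht := by
    obtain ⟨θ, h_mono, -, hθ0, hθ⟩ := h p
    exact ⟨θ t, hθ0 ▸ h_mono ht, hθ t⟩

section Stretch

variable (a b : ℝ)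

/-- The length of the initial and of the final part of a crossing that `stretch a b` only
translates. It is less than half of either duration and tends to `∞` when both durations do. -/
noncomputable def stretchMargin : ℝ := min a b / 2 - 1

/-- The proportion of the part of a crossing of duration `a` affected by `stretch a b` that is over
at time `t`. -/
noncomputable def stretchFraction (t : ℝ) : unitInterval :=
  projIcc 0 1 zero_le_one ((t - stretchMargin a b) / (a - 2 * stretchMargin a b))

/-- The map underlying `stretch`. -/
noncomputable def stretchFun (t : ℝ) : ℝ := t + (b - a) * stretchFraction a b t

theorem stretchMargin_comm : stretchMargin a b = stretchMargin b a := by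
  rw [stretchMargin, stretchMargin, min_comm]

theorem two_mul_stretchMargin_lt_left : 2 * stretchMargin a b < a := by
  have := min_le_left a b
  rw [stretchMargin]
  linarith

theorem two_mul_stretchMargin_lt_right : 2 * stretchMargin a b < b := by
  rw [stretchMargin_comm]
  exact two_mul_stretchMargin_lt_left b a

theorem stretchFraction_stretchFun (t : ℝ) :
    stretchFraction b a (stretchFun a b t) = stretchFraction a b t := by
  have ha := sub_pos.2 (two_mul_stretchMargin_lt_left a b)
  have hb := sub_pos.2 (two_mul_stretchMargin_lt_right a b)
  rw [stretchFun, stretchFraction, stretchMargin_comm b a, stretchFraction]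
  set m := stretchMargin a b
  set y := (t - m) / (a - 2 * m) with hy
  have ht : t = m + y * (a - 2 * m) := by rw [hy, div_mul_cancel₀ _ ha.ne']; ring
  rcases le_total y 0 with h0 | h0
  · rw [projIcc_of_le_left _ h0]
    refine projIcc_of_le_left _ (div_nonpos_of_nonpos_of_nonneg ?_ hb.le)
    nlinarith
  rcases le_total y 1 with h1 | h1
  · rw [projIcc_of_mem _ ⟨h0, h1⟩]
    refine (congrArg _ ?_).trans (projIcc_of_mem zero_le_one ⟨h0, h1⟩)
    rw [div_eq_iff hb.ne', ht]
    ring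
  · rw [projIcc_of_right_le _ h1]
    refine projIcc_of_right_le _ ((le_div_iff₀ hb).2 ?_)
    nlinarith

theorem stretchFun_stretchFun (t : ℝ) : stretchFun b a (stretchFun a b t) = t := by
  rw [stretchFun, stretchFraction_stretchFun, stretchFun]
  ring

theorem monotone_stretchFun : Monotone (stretchFun a b) := by
  intro s t hst
  have ha := sub_pos.2 (two_mul_stretchMargin_lt_left a b)
  have hb := sub_pos.2 (two_mul_stretchMargin_lt_right a b)
  have h_mono : (stretchFraction a b s : ℝ) ≤ stretchFraction a b t :=
    monotone_projIcc _ (div_le_div_of_nonneg_right (sub_le_sub_right hst _) ha.le)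
  have h_lip : (stretchFraction a b t - stretchFraction a b s : ℝ) * (a - 2 * stretchMargin a b)
      ≤ t - s := by
    rw [← le_div_iff₀ ha]
    refine (le_abs_self _).trans ((abs_projIcc_sub_projIcc _).trans_eq ?_)
    rw [← sub_div, sub_sub_sub_cancel_right, abs_of_nonneg (div_nonneg (sub_nonneg.2 hst) ha.le)]
  rw [stretchFun, stretchFun]
  linarith [mul_nonneg (sub_nonneg.2 h_mono) hb.le]

/-- The reparametrization of time that turns a crossing of duration `a` into one of duration `b`:
the piecewise linear map equal to `t ↦ t` for `t ≤ stretchMargin a b` and to `t ↦ t + (b - a)` for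
`t ≥ a - stretchMargin a b`. -/
noncomputable def stretch : ℝ ≃o ℝ :=
  Equiv.toOrderIso ⟨stretchFun a b, stretchFun b a, stretchFun_stretchFun a b,
    stretchFun_stretchFun b a⟩ (monotone_stretchFun a b) (monotone_stretchFun b a)

theorem stretch_apply (t : ℝ) : stretch a b t = t + (b - a) * stretchFraction a b t := rfl

theorem stretch_stretch (t : ℝ) : stretch b a (stretch a b t) = t := stretchFun_stretchFun a b t

variable {a b}

theorem stretch_of_le {t : ℝ} (ht : t ≤ stretchMargin a b) : stretch a b t = t := by
  have ha := sub_pos.2 (two_mul_stretchMargin_lt_left a b)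
  rw [stretch_apply, stretchFraction,
    projIcc_of_le_left _ (div_nonpos_of_nonpos_of_nonneg (sub_nonpos.2 ht) ha.le), mul_zero,
    add_zero]

variable (a b)

theorem stretch_sub (t : ℝ) : stretch a b (a - t) = b - stretch a b t := by
  have ha := sub_pos.2 (two_mul_stretchMargin_lt_left a b)
  have h : (stretchFraction a b (a - t) : ℝ) = 1 - stretchFraction a b t := by
    rw [← unitInterval.coe_symm_eq, stretchFraction, stretchFraction, unitInterval.symm_projIcc,
      one_sub_div ha.ne']
    congr 3
    ring
  rw [stretch_apply, stretch_apply, h]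
  ring

theorem continuous_stretch : Continuous fun q : ℝ × ℝ × ℝ => stretch q.1 q.2.1 q.2.2 := by
  have h_margin : Continuous fun q : ℝ × ℝ × ℝ => stretchMargin q.1 q.2.1 := by
    unfold stretchMargin
    fun_prop
  have h_fraction : Continuous fun q : ℝ × ℝ × ℝ => (stretchFraction q.1 q.2.1 q.2.2 : ℝ) :=
    continuous_subtype_val.comp <| continuous_projIcc.comp <|
      Continuous.div (by fun_prop) (by fun_prop)
        fun q => (sub_pos.2 (two_mul_stretchMargin_lt_left q.1 q.2.1)).ne'
  simp only [stretch_apply]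
  fun_prop

end Stretch

section TimeChange

variable (f g : ℝ → ℝ)

/-- Conversion of time on the leaf `ξ η = x`, measured from a transversal at the boundary leaf
`{ξ = 0}`, from a flow with transit time `f` to a flow with transit time `g`. On the boundary leaf,
where `x = 0`, nothing has to be converted. -/
noncomputable def timeChange (x : ℝ≥0) : ℝ ≃o ℝ :=
  if x = 0 then OrderIso.refl ℝ else stretch (f x) (g x)

theorem timeChange_zero (t : ℝ) : timeChange f g 0 t = t := by simp [timeChange]

theorem timeChange_of_ne_zero {x : ℝ≥0} (hx : x ≠ 0) :
    timeChange f g x = stretch (f x) (g x) := if_neg hx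

theorem timeChange_timeChange (x : ℝ≥0) (t : ℝ) : timeChange g f x (timeChange f g x t) = t := by
  rcases eq_or_ne x 0 with rfl | hx
  · simp only [timeChange_zero]
  · rw [timeChange_of_ne_zero _ _ hx, timeChange_of_ne_zero _ _ hx, stretch_stretch]

theorem timeChange_sub {x : ℝ≥0} (hx : x ≠ 0) (t : ℝ) :
    timeChange f g x (f x - t) = g x - timeChange f g x t := by
  rw [timeChange_of_ne_zero _ _ hx, stretch_sub]

variable {f g}

theorem continuousAt_comp_coe_of_mem_reebE (hf : f ∈ reebE) {x : ℝ≥0} (hx : x ≠ 0) :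
    ContinuousAt (fun y : ℝ≥0 => f y) x :=
  ContinuousAt.comp (f := ((↑) : ℝ≥0 → ℝ))
    (hf.1.continuousAt (Ioi_mem_nhds (NNReal.coe_pos.2 (pos_iff_ne_zero.2 hx))))
    NNReal.continuous_coe.continuousAt

theorem tendsto_comp_coe_of_mem_reebE (hf : f ∈ reebE) :
    Tendsto (fun x : ℝ≥0 => f x) (𝓝[>] 0) atTop :=
  hf.2.comp <| tendsto_nhdsWithin_iff.2
    ⟨(NNReal.continuous_coe.tendsto' 0 0 NNReal.coe_zero).mono_left nhdsWithin_le_nhds,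
      eventually_mem_nhdsWithin.mono fun _ hx => NNReal.coe_pos.2 hx⟩

theorem eventually_timeChange_eq (hf : f ∈ reebE) (hg : g ∈ reebE) (T : ℝ) :
    ∀ᶠ x : ℝ≥0 in 𝓝 0, ∀ t ≤ T, timeChange f g x t = t := by
  have h_large : ∀ᶠ x : ℝ≥0 in 𝓝[>] 0, 2 * (T + 1) ≤ min (f x) (g x) :=
    ((tendsto_comp_coe_of_mem_reebE hf).eventually_ge_atTop _).and
      ((tendsto_comp_coe_of_mem_reebE hg).eventually_ge_atTop _) |>.mono fun _ h => le_min h.1 h.2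
  filter_upwards [eventually_nhdsWithin_iff.1 h_large] with x hx t ht
  rcases eq_or_ne x 0 with rfl | hx0
  · exact timeChange_zero f g t
  · rw [timeChange_of_ne_zero _ _ hx0, stretch_of_le]
    have := hx (pos_iff_ne_zero.2 hx0)
    rw [stretchMargin]
    linarith

theorem continuous_timeChange (hf : f ∈ reebE) (hg : g ∈ reebE) :
    Continuous fun q : ℝ≥0 × ℝ => timeChange f g q.1 q.2 := by
  rw [continuous_iff_continuousAt]
  rintro ⟨x, t⟩
  rcases eq_or_ne x 0 with rfl | hx
  · refine (continuousAt_snd (X := ℝ≥0)).congr ?_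
    filter_upwards [continuousAt_fst.eventually (eventually_timeChange_eq hf hg (t + 1)),
      continuousAt_snd.eventually_le_const (lt_add_one t)] with q hq hqt using (hq _ hqt).symm
  · have h_stretch : ContinuousAt (fun q : ℝ≥0 × ℝ => stretch (f q.1) (g q.1) q.2) (x, t) :=
      ContinuousAt.comp (f := fun q : ℝ≥0 × ℝ => (f q.1, g q.1, q.2))
        continuous_stretch.continuousAt <|
        (ContinuousAt.fst'' (continuousAt_comp_coe_of_mem_reebE hf hx)).prodMk <|
          (ContinuousAt.fst'' (continuousAt_comp_coe_of_mem_reebE hg hx)).prodMk continuousAt_snd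
    refine h_stretch.congr ?_
    filter_upwards [(continuousAt_fst (p := (x, t))).eventually_ne hx] with q hq
    rw [timeChange_of_ne_zero f g hq]

end TimeChange

/-- The time that the standard Reeb flow needs to move from `(x, 1)` to `(1, x)`. -/
noncomputable def standardTransitTime (x : ℝ) : ℝ := -Real.log x

theorem standardTransitTime_mem_reebE : standardTransitTime ∈ reebE :=
  ⟨(Real.continuousOn_log.mono fun _ hx => ne_of_gt hx).neg,
    tendsto_neg_atBot_atTop.comp Real.tendsto_log_nhdsGT_zero⟩

namespace ReebPlane

/-- The parameter `ξ η` of the leaf through a point. -/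
def leaf (p : ReebPlane) : ℝ≥0 := ⟨p.1.1 * p.1.2, mul_nonneg p.2.1 p.2.2.1⟩

/-- The reflection `(ξ, η) ↦ (η, ξ)`, which exchanges the boundary leaves and reverses the standard
Reeb flow. -/
def swap (p : ReebPlane) : ReebPlane :=
  ⟨(p.1.2, p.1.1), p.2.2.1, p.2.1, fun h => p.2.2.2 (Prod.ext (congrArg Prod.snd h)
    (congrArg Prod.fst h))⟩

/-- The transversal `{η = 1}` to the leaves at `{ξ = 0}`, parametrized by the leaves. -/
def base (x : ℝ≥0) : ReebPlane := ⟨(x, 1), x.2, zero_le_one, by simp⟩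

theorem coe_leaf (p : ReebPlane) : (leaf p : ℝ) = p.1.1 * p.1.2 := rfl

theorem fst_pos_or_snd_pos (p : ReebPlane) : 0 < p.1.1 ∨ 0 < p.1.2 := by
  by_contra! h
  exact p.2.2.2 (Prod.ext (le_antisymm h.1 p.2.1) (le_antisymm h.2 p.2.2.1))

theorem mem_inner_iff {p : ReebPlane} : p ∈ inner ↔ leaf p ≠ 0 := by
  rw [← NNReal.coe_ne_zero, coe_leaf, mul_ne_zero_iff]
  exact ⟨fun h => ⟨h.1.ne', h.2.ne'⟩, fun h => ⟨p.2.1.lt_of_ne' h.1, p.2.2.1.lt_of_ne' h.2⟩⟩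

theorem leaf_eq_zero_of_mem_xiZero {p : ReebPlane} (hp : p ∈ xiZero) : leaf p = 0 :=
  NNReal.eq (mul_eq_zero_of_left hp _)

theorem leaf_eq_zero_of_mem_etaZero {p : ReebPlane} (hp : p ∈ etaZero) : leaf p = 0 :=
  NNReal.eq (mul_eq_zero_of_right _ hp)

theorem continuous_leaf : Continuous leaf := by
  unfold leaf
  fun_prop

theorem continuous_swap : Continuous swap := by
  unfold swap
  fun_prop

theorem continuous_base : Continuous base := by
  unfold base
  fun_prop

theorem base_fst (x : ℝ≥0) : (base x).1.1 = x := rfl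

theorem base_snd (x : ℝ≥0) : (base x).1.2 = 1 := rfl

@[simp]
theorem swap_swap (p : ReebPlane) : swap (swap p) = p := rfl

@[simp]
theorem leaf_swap (p : ReebPlane) : leaf (swap p) = leaf p := NNReal.eq (mul_comm _ _)

@[simp]
theorem leaf_base (x : ℝ≥0) : leaf (base x) = x := NNReal.eq (mul_one _)

theorem standardReebFlow_fst (s : ℝ) (p : ReebPlane) :
    (standardReebFlow s p).1.1 = Real.exp s * p.1.1 := rfl

theorem standardReebFlow_snd (s : ℝ) (p : ReebPlane) :
    (standardReebFlow s p).1.2 = Real.exp (-s) * p.1.2 := rfl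

@[simp]
theorem leaf_standardReebFlow (s : ℝ) (p : ReebPlane) : leaf (standardReebFlow s p) = leaf p := by
  apply NNReal.eq
  simp only [coe_leaf, standardReebFlow_fst, standardReebFlow_snd, Real.exp_neg]
  field_simp

theorem swap_standardReebFlow (s : ℝ) (p : ReebPlane) :
    swap (standardReebFlow s p) = standardReebFlow (-s) (swap p) := by
  apply Subtype.ext
  ext
  · rfl
  · simp only [swap, standardReebFlow_fst, standardReebFlow_snd, neg_neg]

theorem standardReebFlow_base_leaf {p : ReebPlane} (hp : 0 < p.1.2) :
    standardReebFlow (-Real.log p.1.2) (base (leaf p)) = p := by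
  apply Subtype.ext
  ext
  · rw [standardReebFlow_fst, Real.exp_neg, Real.exp_log hp, base_fst, coe_leaf]
    field_simp
  · rw [standardReebFlow_snd, neg_neg, Real.exp_log hp, base_snd, mul_one]

theorem standardReebFlow_standardTransitTime_base {x : ℝ≥0} (hx : x ≠ 0) :
    standardReebFlow (standardTransitTime x) (base x) = swap (base x) := by
  have hx' : (0 : ℝ) < x := NNReal.coe_pos.2 (pos_iff_ne_zero.2 hx)
  have h := standardReebFlow_base_leaf (p := swap (base x)) hx'
  rwa [leaf_swap, leaf_base] at h

theorem leaf_eq_of_mem_orbit {p q : ReebPlane} (h : q ∈ standardReebFlow.orbit p) :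
    leaf q = leaf p := by
  obtain ⟨s, rfl⟩ := (Flow.mem_orbit_iff _).1 h
  exact leaf_standardReebFlow s p

theorem mem_orbit_of_leaf_eq {p q : ReebPlane} (hp : p ∈ inner) (h : leaf q = leaf p) :
    q ∈ standardReebFlow.orbit p := by
  have hq : q ∈ inner := by rwa [mem_inner_iff, h, ← mem_inner_iff]
  rw [Flow.mem_orbit_iff, ← standardReebFlow_base_leaf hp.2, ← standardReebFlow_base_leaf hq.2, h]
  exact ⟨-Real.log q.1.2 + Real.log p.1.2, by rw [← Flow.map_add, add_neg_cancel_right]⟩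

section Chart

variable (f : ℝ → ℝ)

/-- The point at time `t` on the leaf `ξ η = x`, in the flow box around the boundary leaf `{ξ = 0}`
of a flow with transit time `f`. Its mirror image `swap (leftPoint f x (-t))` is the point at time
`t` in the flow box around `{η = 0}`. -/
noncomputable def leftPoint (x : ℝ≥0) (t : ℝ) : ReebPlane :=
  standardReebFlow (timeChange f standardTransitTime x t) (base x)

/-- The time coordinate in the flow box parametrized by `leftPoint f`. -/
noncomputable def leftTime (p : ReebPlane) : ℝ :=
  timeChange standardTransitTime f (leaf p) (-Real.log p.1.2)

@[simp]
theorem leaf_leftPoint (x : ℝ≥0) (t : ℝ) : leaf (leftPoint f x t) = x := by simp [leftPoint]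

theorem leftPoint_snd (x : ℝ≥0) (t : ℝ) :
    (leftPoint f x t).1.2 = Real.exp (-timeChange f standardTransitTime x t) := by
  rw [leftPoint, standardReebFlow_snd, base_snd, mul_one]

theorem leftPoint_snd_pos (x : ℝ≥0) (t : ℝ) : 0 < (leftPoint f x t).1.2 := by
  rw [leftPoint_snd]
  exact Real.exp_pos _

@[simp]
theorem leftTime_leftPoint (x : ℝ≥0) (t : ℝ) : leftTime f (leftPoint f x t) = t := by
  rw [leftTime, leaf_leftPoint, leftPoint_snd, Real.log_exp, neg_neg, timeChange_timeChange]

theorem leftPoint_leaf_leftTime {p : ReebPlane} (hp : 0 < p.1.2) :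
    leftPoint f (leaf p) (leftTime f p) = p := by
  rw [leftPoint, leftTime, timeChange_timeChange, standardReebFlow_base_leaf hp]

theorem swap_leftPoint {x : ℝ≥0} (hx : x ≠ 0) (t : ℝ) :
    swap (leftPoint f x t) = leftPoint f x (f x - t) := by
  rw [leftPoint, leftPoint, timeChange_sub f _ hx, swap_standardReebFlow,
    ← standardReebFlow_standardTransitTime_base hx, ← Flow.map_add, neg_add_eq_sub]

theorem exists_eq_leftPoint_or_eq_swap_leftPoint (p : ReebPlane) :
    ∃ x t, p = leftPoint f x t ∨ p = swap (leftPoint f x t) := by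
  rcases fst_pos_or_snd_pos p with hp | hp
  · exact ⟨_, _, Or.inr (congrArg swap (leftPoint_leaf_leftTime f (p := swap p) hp)).symm⟩
  · exact ⟨_, _, Or.inl (leftPoint_leaf_leftTime f hp).symm⟩

theorem standardReebFlow_leftPoint (x : ℝ≥0) (r t : ℝ) :
    standardReebFlow
        (timeChange f standardTransitTime x t - timeChange f standardTransitTime x r)
        (leftPoint f x r) = leftPoint f x t := by
  rw [leftPoint, leftPoint, ← Flow.map_add, sub_add_cancel]

variable {f}

theorem continuous_leftPoint (hf : f ∈ reebE) :
    Continuous fun q : ℝ≥0 × ℝ => leftPoint f q.1 q.2 :=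
  standardReebFlow.continuous (continuous_timeChange hf standardTransitTime_mem_reebE)
    (continuous_base.comp continuous_fst)

theorem continuousOn_leftTime (hf : f ∈ reebE) : ContinuousOn (leftTime f) {p | 0 < p.1.2} :=
  (continuous_timeChange standardTransitTime_mem_reebE hf).comp_continuousOn <|
    continuous_leaf.continuousOn.prodMk
      (ContinuousOn.log (by fun_prop) fun _ hp => ne_of_gt hp).neg

end Chart

section ChartAffine

/-- The map that multiplies the leaf parameter by `l` and acts by `t ↦ m * t + c` on the times of
both flow boxes. The two descriptions agree on the interior leaves when `f (l * x) = m * f x`. -/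
noncomputable def chartAffine (f : ℝ → ℝ) (l : ℝ≥0) (m c : ℝ) (p : ReebPlane) : ReebPlane :=
  if 0 < p.1.2 then leftPoint f (l * leaf p) (m * leftTime f p + c)
  else swap (leftPoint f (l * leaf p) (m * leftTime f (swap p) - c))

variable {f : ℝ → ℝ} {l : ℝ≥0} {m : ℝ}

theorem chartAffine_leftPoint (c : ℝ) (x : ℝ≥0) (t : ℝ) :
    chartAffine f l m c (leftPoint f x t) = leftPoint f (l * x) (m * t + c) := by
  rw [chartAffine, if_pos (leftPoint_snd_pos f x t), leaf_leftPoint, leftTime_leftPoint]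

variable (hl : l ≠ 0) (hf : ∀ x : ℝ, 0 < x → f (l * x) = m * f x)
include hl hf

theorem chartAffine_swap_leftPoint (c : ℝ) (x : ℝ≥0) (t : ℝ) :
    chartAffine f l m c (swap (leftPoint f x t)) = swap (leftPoint f (l * x) (m * t - c)) := by
  rcases eq_or_ne x 0 with rfl | hx
  · have h_snd : ¬ 0 < (swap (leftPoint f 0 t)).1.2 := fun h =>
      mem_inner_iff.1 ⟨h, leftPoint_snd_pos f 0 t⟩ (leaf_leftPoint f 0 t)
    rw [chartAffine, if_neg h_snd, swap_swap, leaf_swap, leaf_leftPoint, leftTime_leftPoint]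
  · rw [swap_leftPoint f hx, chartAffine_leftPoint, swap_leftPoint f (mul_ne_zero hl hx),
      NNReal.coe_mul, hf x (NNReal.coe_pos.2 (pos_iff_ne_zero.2 hx))]
    congr 1
    ring

theorem chartAffine_swap (c : ℝ) (p : ReebPlane) :
    chartAffine f l m c (swap p) = swap (chartAffine f l m (-c) p) := by
  obtain ⟨x, t, rfl | rfl⟩ := exists_eq_leftPoint_or_eq_swap_leftPoint f p
  · rw [chartAffine_swap_leftPoint hl hf, chartAffine_leftPoint, sub_eq_add_neg]
  · rw [swap_swap, chartAffine_swap_leftPoint hl hf, chartAffine_leftPoint, swap_swap,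
      sub_neg_eq_add]

theorem chartAffine_chartAffine {l' : ℝ≥0} {m' : ℝ} (hl' : l' ≠ 0)
    (hf' : ∀ x : ℝ, 0 < x → f (l' * x) = m' * f x) (c c' : ℝ) (p : ReebPlane) :
    chartAffine f l' m' c' (chartAffine f l m c p) =
      chartAffine f (l' * l) (m' * m) (m' * c + c') p := by
  have hf'' (x : ℝ) (hx : 0 < x) : f ((l' * l : ℝ≥0) * x) = m' * m * f x := by
    rw [NNReal.coe_mul, mul_assoc, hf' _ (by positivity), hf x hx, mul_assoc]
  obtain ⟨x, t, rfl | rfl⟩ := exists_eq_leftPoint_or_eq_swap_leftPoint f p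
  · simp only [chartAffine_leftPoint]
    ring_nf
  · simp only [chartAffine_swap_leftPoint hl hf, chartAffine_swap_leftPoint hl' hf',
      chartAffine_swap_leftPoint (mul_ne_zero hl' hl) hf'']
    ring_nf

omit hl hf in
theorem chartAffine_one (p : ReebPlane) : chartAffine f 1 1 0 p = p := by
  obtain ⟨x, t, rfl | rfl⟩ := exists_eq_leftPoint_or_eq_swap_leftPoint f p
  · simp [chartAffine_leftPoint]
  · simp [chartAffine_swap_leftPoint]

theorem continuous_chartAffine (hfE : f ∈ reebE) :
    Continuous fun q : ℝ × ReebPlane => chartAffine f l m q.1 q.2 := by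
  have h_left : ContinuousOn (fun q : ℝ × ReebPlane => chartAffine f l m q.1 q.2)
      {q | 0 < q.2.1.2} := by
    have h_time : ContinuousOn (fun q : ℝ × ReebPlane => leftTime f q.2) {q | 0 < q.2.1.2} :=
      (continuousOn_leftTime hfE).comp continuousOn_snd fun _ hq => hq
    refine ((continuous_leftPoint hfE).comp_continuousOn
      ((continuous_const.mul (continuous_leaf.comp continuous_snd)).continuousOn.prodMk
        ((h_time.const_mul m).add continuousOn_fst))).congr fun q hq => if_pos hq
  have h_right : ContinuousOn (fun q : ℝ × ReebPlane => chartAffine f l m q.1 q.2)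
      {q | 0 < q.2.1.1} := by
    refine (continuous_swap.comp_continuousOn (h_left.comp
      (continuous_fst.neg.prodMk (continuous_swap.comp continuous_snd)).continuousOn
      fun _ hq => hq)).congr fun q _ => ?_
    exact chartAffine_swap hl hf q.1 (swap q.2)
  rw [continuous_iff_continuousAt]
  intro q
  rcases fst_pos_or_snd_pos q.2 with hq | hq
  · exact h_right.continuousAt ((isOpen_lt continuous_const (by fun_prop)).mem_nhds hq)
  · exact h_left.continuousAt ((isOpen_lt continuous_const (by fun_prop)).mem_nhds hq)

end ChartAffine

section ReebFlow

variable {f : ℝ → ℝ} (hf : f ∈ reebE)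

/-- The `ℛ`-flow with transit time `f`: translation of time in the two flow boxes. -/
noncomputable def reebFlow : Flow ℝ ReebPlane where
  toFun := chartAffine f 1 1
  cont' := continuous_chartAffine one_ne_zero (by simp) hf
  map_add' s t p := by
    rw [chartAffine_chartAffine one_ne_zero (by simp) one_ne_zero (by simp), mul_one, one_mul,
      one_mul, add_comm]
  map_zero' := chartAffine_one

theorem reebFlow_apply (t : ℝ) (p : ReebPlane) : reebFlow hf t p = chartAffine f 1 1 t p := rfl

theorem reebFlow_leftPoint (t : ℝ) (x : ℝ≥0) (r : ℝ) :
    reebFlow hf t (leftPoint f x r) = leftPoint f x (r + t) := by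
  rw [reebFlow_apply, chartAffine_leftPoint, one_mul, one_mul]

theorem reebFlow_swap_leftPoint (t : ℝ) (x : ℝ≥0) (r : ℝ) :
    reebFlow hf t (swap (leftPoint f x r)) = swap (leftPoint f x (r - t)) := by
  rw [reebFlow_apply, chartAffine_swap_leftPoint one_ne_zero (by simp), one_mul, one_mul]

theorem isReebFlow_reebFlow : IsReebFlow (reebFlow hf) := by
  refine IsReebFlow.of_timeChange fun p => ?_
  obtain ⟨x, r, hp⟩ := exists_eq_leftPoint_or_eq_swap_leftPoint f p
  set σ := timeChange f standardTransitTime x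
  rcases hp with rfl | rfl
  · refine ⟨fun t => σ (r + t) - σ r, fun s t hst => ?_, fun s => ?_, by simp, fun t => ?_⟩
    · simpa using hst
    · exact ⟨σ.symm (s + σ r) - r, by simp⟩
    · rw [reebFlow_leftPoint, standardReebFlow_leftPoint]
  · refine ⟨fun t => σ r - σ (r - t), fun s t hst => ?_, fun s => ?_, by simp, fun t => ?_⟩
    · simpa using hst
    · exact ⟨r - σ.symm (σ r - s), by simp⟩
    · rw [reebFlow_swap_leftPoint, ← standardReebFlow_leftPoint f x r, swap_standardReebFlow,
        neg_sub]

theorem isReebTransversal_of_leaf_eq {B : Set ReebPlane} {γ : ℝ≥0 → ReebPlane} (hγ : Continuous γ)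
    (h_leaf : ∀ x, leaf (γ x) = x) (h_start : γ 0 ∈ B) : IsReebTransversal B γ where
  continuous := hγ
  start := h_start
  mem_inner x hx := by rw [mem_inner_iff, h_leaf]; exact hx.ne'
  meets p hp := by
    refine ⟨leaf p, mem_orbit_of_leaf_eq hp (h_leaf _), fun x hx => ?_⟩
    rw [← leaf_eq_of_mem_orbit hx, h_leaf]

include hf in
theorem isReebTransversal_leftPoint : IsReebTransversal xiZero fun x => leftPoint f x 0 := by
  refine isReebTransversal_of_leaf_eq
    ((continuous_leftPoint hf).comp (continuous_id.prodMk continuous_const))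
    (fun x => leaf_leftPoint f x 0) ?_
  have h_leaf : ((leaf (leftPoint f 0 0) : ℝ≥0) : ℝ) = 0 := by simp
  exact (mul_eq_zero.1 h_leaf).resolve_right (leftPoint_snd_pos f 0 0).ne'

include hf in
theorem isReebTransversal_swap_leftPoint :
    IsReebTransversal etaZero fun x => swap (leftPoint f x 0) :=
  isReebTransversal_of_leaf_eq (continuous_swap.comp (isReebTransversal_leftPoint hf).continuous)
    (by simp) (isReebTransversal_leftPoint hf).start

theorem isTransitTime_reebFlow :
    IsTransitTime (reebFlow hf) (fun x => leftPoint f x 0) (fun x => swap (leftPoint f x 0)) f := by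
  intro x hx t
  have h_end : swap (leftPoint f x 0) = leftPoint f x (f x) := by
    rw [swap_leftPoint f hx.ne', sub_zero]
  rw [reebFlow_leftPoint, zero_add]
  constructor
  · rintro ⟨y, hy⟩
    obtain rfl : y = x := by simpa using congrArg leaf hy
    simpa using congrArg (leftTime f) (hy.symm.trans h_end)
  · rintro rfl
    exact ⟨x, h_end⟩

theorem isConjugate_rescale_reebFlow {l : ℝ≥0} {c : ℝ} (hl : l ≠ 0) (hc : c ≠ 0)
    (h : ∀ x : ℝ, 0 < x → f (x / l) = c * f x) :
    ((reebFlow hf).rescale c).IsConjugate (reebFlow hf) := by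
  have h_inv (x : ℝ) (hx : 0 < x) : f ((l⁻¹ : ℝ≥0) * x) = c * f x := by
    rw [NNReal.coe_inv, inv_mul_eq_div, h x hx]
  have h_mul (x : ℝ) (hx : 0 < x) : f (l * x) = c⁻¹ * f x := by
    have hlx : 0 < l * x := mul_pos (NNReal.coe_pos.2 (pos_iff_ne_zero.2 hl)) hx
    rw [eq_inv_mul_iff_mul_eq₀ hc, ← h _ hlx, mul_div_cancel_left₀ x (NNReal.coe_ne_zero.2 hl)]
  let e : ReebPlane ≃ₜ ReebPlane :=
    { toFun := chartAffine f l c⁻¹ 0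
      invFun := chartAffine f l⁻¹ c 0
      left_inv p := by
        rw [chartAffine_chartAffine hl h_mul (inv_ne_zero hl) h_inv, inv_mul_cancel₀ hl,
          mul_inv_cancel₀ hc, mul_zero, add_zero, chartAffine_one]
      right_inv p := by
        rw [chartAffine_chartAffine (inv_ne_zero hl) h_inv hl h_mul, mul_inv_cancel₀ hl,
          inv_mul_cancel₀ hc, mul_zero, add_zero, chartAffine_one]
      continuous_toFun :=
        (continuous_chartAffine hl h_mul hf).comp (Continuous.prodMk_right 0)
      continuous_invFun :=
        (continuous_chartAffine (inv_ne_zero hl) h_inv hf).comp (Continuous.prodMk_right 0) }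
  refine ⟨e, e.continuous, e.surjective, fun t p => ?_⟩
  change chartAffine f l c⁻¹ 0 (chartAffine f 1 1 (c * t) p) =
    chartAffine f 1 1 t (chartAffine f l c⁻¹ 0 p)
  rw [chartAffine_chartAffine one_ne_zero (by simp) hl h_mul,
    chartAffine_chartAffine hl h_mul one_ne_zero (by simp), inv_mul_cancel_left₀ hc]
  simp only [mul_one, one_mul, mul_zero, zero_add, add_zero]

end ReebFlow

end ReebPlane

section ReebSigma

variable {f : ℝ → ℝ}

theorem sub_le_reebStar (hf : ContinuousOn f (Ioi 0)) {x y : ℝ} (hx : 0 < x) (hxy : x ≤ y)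
    (hy : y ≤ 1) : f y - f x ≤ reebStar f x := by
  have h_bdd : BddAbove (f '' Icc x 1) :=
    (isCompact_Icc.image_of_continuousOn (hf.mono fun _ hz => hx.trans_le hz.1)).bddAbove
  exact sub_le_sub_right (le_csSup h_bdd (mem_image_of_mem f ⟨hxy, hy⟩)) _

theorem reebSigma_le_of_eventually (hf : f ∈ reebE) {C : ℝ}
    (h : ∀ᶠ y in 𝓝[>] 0, ∀ x ∈ Ioc 0 y, f y ≤ f x + C) : reebSigma f ≤ C := by
  obtain ⟨δ, hδ, h⟩ := (nhdsGT_basis (0 : ℝ)).eventually_iff.1 h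
  obtain ⟨d, hd, hdδ⟩ := exists_between hδ
  obtain ⟨M, hM⟩ : BddAbove (f '' Icc d 1) :=
    (isCompact_Icc.image_of_continuousOn (hf.1.mono fun _ hz => hd.trans_le hz.1)).bddAbove
  refine limsup_le_of_le (by isBoundedDefault) ?_
  filter_upwards [Ioo_mem_nhdsGT (lt_min hd one_pos), hf.2.eventually_ge_atTop (M - C)]
    with x hx hxM
  have hx1 : x ≤ 1 := (hx.2.trans_le (min_le_right _ _)).le
  rw [EReal.coe_le_coe_iff, reebStar, sub_le_iff_le_add']
  refine csSup_le ((nonempty_Icc.2 hx1).image f) ?_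
  rintro _ ⟨y, hy, rfl⟩
  rcases le_total y d with hyd | hyd
  · exact h ⟨hx.1.trans_le hy.1, hyd.trans_lt hdδ⟩ x ⟨hx.1, hy.1⟩
  · linarith [hM (mem_image_of_mem f ⟨hyd, hy.2⟩)]

theorem reebSigma_nonpos_of_tendsto_add_log (hf : f ∈ reebE) {g : ℝ≥0 → ℝ≥0} {δ : ℝ≥0}
    (hδ : 0 < δ) (hg : StrictMonoOn g (Icc 0 δ)) {L : ℝ}
    (h : Tendsto (fun x : ℝ≥0 => f x + Real.log (g x)) (𝓝[>] 0) (𝓝 L)) : reebSigma f ≤ 0 := by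
  refine EReal.le_of_forall_lt_iff_le.1 fun ε hε => reebSigma_le_of_eventually hf ?_
  have hε2 : 0 < ε / 2 := half_pos (EReal.coe_pos.1 hε)
  obtain ⟨d, hd, h_close⟩ := (nhdsGT_basis (0 : ℝ≥0)).eventually_iff.1
    (Metric.tendsto_nhds.1 h _ hε2)
  filter_upwards [Ioo_mem_nhdsGT (NNReal.coe_pos.2 (lt_min hd hδ))] with y hy x hx
  lift y to ℝ≥0 using hy.1.le
  lift x to ℝ≥0 using hx.1.le
  simp only [mem_Ioo, mem_Ioc, NNReal.coe_pos, NNReal.coe_lt_coe, NNReal.coe_le_coe,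
    lt_min_iff] at hy hx
  have h_x := abs_lt.1 (h_close ⟨hx.1, hx.2.trans_lt hy.2.1⟩)
  have h_y := abs_lt.1 (h_close ⟨hy.1, hy.2.1⟩)
  have hx_mem : x ∈ Icc 0 δ := ⟨hx.1.le, hx.2.trans hy.2.2.le⟩
  have h_log : Real.log (g x) ≤ Real.log (g y) :=
    Real.log_le_log
      (NNReal.coe_pos.2 (zero_le.trans_lt (hg (left_mem_Icc.2 hδ.le) hx_mem hx.1)))
      (NNReal.coe_le_coe.2 (hg.monotoneOn hx_mem ⟨hy.1.le, hy.2.2.le⟩ hx.2))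
  linarith [h_x.1, h_y.2]

theorem apply_div_pow_of_apply_div {l c : ℝ} (hl : 0 < l)
    (h : ∀ x, 0 < x → f (x / l) = c * f x) {x : ℝ} (hx : 0 < x) (n : ℕ) :
    f (x / l ^ n) = c ^ n * f x := by
  induction n with
  | zero => simp
  | succ n ih => rw [pow_succ, ← div_div, h _ (by positivity), ih, pow_succ', mul_assoc]

theorem reebSigma_eq_top_of_apply_div (hf : ContinuousOn f (Ioi 0)) {l c : ℝ} (hl : 1 < l)
    (hc : 1 < c) (h : ∀ x, 0 < x → f (x / l) = c * f x) {a b : ℝ} (ha : 0 < a) (hab : a < b)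
    (hfab : f a < f b) : reebSigma f = ⊤ := by
  have hl0 : 0 < l := one_pos.trans hl
  have hb : 0 < b := ha.trans hab
  have h_pow := tendsto_pow_atTop_atTop_of_one_lt hl
  have h_zero : Tendsto (fun n : ℕ => a / l ^ n) atTop (𝓝[>] 0) :=
    tendsto_nhdsWithin_iff.2
      ⟨h_pow.const_div_atTop a, Eventually.of_forall fun n => div_pos ha (pow_pos hl0 n)⟩
  have h_star : Tendsto (fun n : ℕ => reebStar f (a / l ^ n)) atTop atTop := by
    refine tendsto_atTop_mono' _ ?_
      ((tendsto_pow_atTop_atTop_of_one_lt hc).atTop_mul_const (sub_pos.2 hfab))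
    filter_upwards [h_pow.eventually_ge_atTop b] with n hn
    have hln : 0 < l ^ n := pow_pos hl0 n
    rw [mul_sub, ← apply_div_pow_of_apply_div hl0 h hb, ← apply_div_pow_of_apply_div hl0 h ha]
    exact sub_le_reebStar hf (div_pos ha hln) (div_le_div_of_nonneg_right hab.le hln.le)
      ((div_le_one hln).2 hn)
  refine EReal.eq_top_iff_forall_lt _ |>.2 fun C => (EReal.coe_lt_coe_iff.2 (lt_add_one C)).trans_le
    (le_limsup_of_frequently_le' (h_zero.frequently (Eventually.frequently ?_)))
  filter_upwards [h_star.eventually_ge_atTop (C + 1)] with n hn using EReal.coe_le_coe_iff.2 hn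

end ReebSigma

section Conjugacy

open ReebPlane

section Crossing

variable {ι : Type*} {F : Filter ι} {s : ι → ℝ} {u : ι → ReebPlane} {q r : ReebPlane}
  (hs : Tendsto s F atTop) (hu : Tendsto u F (𝓝 q))
  (hv : Tendsto (fun i => standardReebFlow (s i) (u i)) F (𝓝 r))
include hs hu hv

theorem mem_xiZero_of_tendsto_standardReebFlow [F.NeBot] : q ∈ xiZero := by
  have h_fst : Continuous fun p : ReebPlane => p.1.1 := by fun_prop
  have h_zero : Tendsto (fun i => Real.exp (-s i) * (standardReebFlow (s i) (u i)).1.1) F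
      (𝓝 (0 * r.1.1)) :=
    (Real.tendsto_exp_neg_atTop_nhds_zero.comp hs).mul ((h_fst.tendsto r).comp hv)
  rw [zero_mul] at h_zero
  refine tendsto_nhds_unique ((h_fst.tendsto q).comp hu) (h_zero.congr fun i => ?_)
  rw [standardReebFlow_fst, ← mul_assoc, ← Real.exp_add, neg_add_cancel, Real.exp_zero, one_mul]
  rfl

theorem mem_etaZero_of_tendsto_standardReebFlow [F.NeBot] : r ∈ etaZero := by
  refine mem_xiZero_of_tendsto_standardReebFlow (q := swap r) (r := swap q) hs
    ((continuous_swap.tendsto r).comp hv)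
    (((continuous_swap.tendsto q).comp hu).congr fun i => ?_)
  rw [Function.comp_apply, Function.comp_apply, swap_standardReebFlow, ← Flow.map_add,
    add_neg_cancel, Flow.map_zero_apply]

theorem fst_mul_snd_pos_of_tendsto_standardReebFlow [F.NeBot] : 0 < r.1.1 * q.1.2 := by
  have hq : q.1.1 = 0 := mem_xiZero_of_tendsto_standardReebFlow hs hu hv
  have hr : r.1.2 = 0 := mem_etaZero_of_tendsto_standardReebFlow hs hu hv
  exact mul_pos ((fst_pos_or_snd_pos r).resolve_right hr.not_gt)
    ((fst_pos_or_snd_pos q).resolve_left hq.not_gt)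

omit hs in
theorem tendsto_exp_mul_leaf :
    Tendsto (fun i => Real.exp (s i) * leaf (u i)) F (𝓝 (r.1.1 * q.1.2)) := by
  have h_fst : Continuous fun p : ReebPlane => p.1.1 := by fun_prop
  have h_snd : Continuous fun p : ReebPlane => p.1.2 := by fun_prop
  refine (((h_fst.tendsto r).comp hv).mul ((h_snd.tendsto q).comp hu)).congr fun i => ?_
  rw [coe_leaf, ← mul_assoc]
  rfl

theorem eventually_leaf_ne_zero [F.NeBot] : ∀ᶠ i in F, leaf (u i) ≠ 0 := by
  filter_upwards [(tendsto_exp_mul_leaf hu hv).eventually_const_lt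
    (fst_mul_snd_pos_of_tendsto_standardReebFlow hs hu hv)] with i hi h
  simp [h] at hi

theorem tendsto_add_log_leaf [F.NeBot] :
    Tendsto (fun i => s i + Real.log (leaf (u i))) F (𝓝 (Real.log (r.1.1 * q.1.2))) := by
  refine ((tendsto_exp_mul_leaf hu hv).log
    (fst_mul_snd_pos_of_tendsto_standardReebFlow hs hu hv).ne').congr' ?_
  filter_upwards [eventually_leaf_ne_zero hs hu hv] with i hi
  rw [Real.log_mul (Real.exp_ne_zero _) (NNReal.coe_ne_zero.2 hi), Real.log_exp]

end Crossing

section Transversal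

variable {B : Set ReebPlane} {γ : ℝ≥0 → ReebPlane}

theorem IsReebTransversal.injective_leaf (hγ : IsReebTransversal B γ) (h0 : leaf (γ 0) = 0) :
    Function.Injective fun x => leaf (γ x) := by
  have h_pos (x : ℝ≥0) : leaf (γ x) = 0 ↔ x = 0 := by
    refine ⟨fun h => ?_, fun h => h ▸ h0⟩
    by_contra hx
    exact mem_inner_iff.1 (hγ.mem_inner x (pos_iff_ne_zero.2 hx)) h
  intro x y hxy
  rcases eq_or_ne x 0 with rfl | hx
  · exact ((h_pos y).1 (hxy.symm.trans h0)).symm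
  · have h_inner := hγ.mem_inner x (pos_iff_ne_zero.2 hx)
    exact (hγ.meets _ h_inner).unique (mem_orbit_of_leaf_eq h_inner rfl)
      (mem_orbit_of_leaf_eq h_inner hxy.symm)

theorem IsReebTransversal.surjective_leaf (hγ : IsReebTransversal B γ) (h0 : leaf (γ 0) = 0) :
    Function.Surjective fun x => leaf (γ x) := by
  intro y
  rcases eq_or_ne y 0 with rfl | hy
  · exact ⟨0, h0⟩
  · obtain ⟨x, hx, -⟩ := hγ.meets (base y) (mem_inner_iff.2 (by rwa [leaf_base]))
    exact ⟨x, (leaf_eq_of_mem_orbit hx).trans (leaf_base y)⟩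

theorem IsReebTransversal.strictMono_leaf (hγ : IsReebTransversal B γ) (h0 : leaf (γ 0) = 0) :
    StrictMono fun x => leaf (γ x) := by
  refine ((continuous_leaf.comp hγ.continuous).strictMono_of_inj
    (hγ.injective_leaf h0)).resolve_right fun h_anti => ?_
  exact not_lt_zero ((h_anti one_pos).trans_eq h0)

end Transversal

theorem IsTransitTime.tendsto {φ : Flow ℝ ReebPlane} {B₁ B₂ : Set ReebPlane}
    {γ₁ γ₂ : ℝ≥0 → ReebPlane} {f : ℝ → ℝ} (hf : IsTransitTime φ γ₁ γ₂ f) (hφ : IsReebFlow φ)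
    (h₁ : IsReebTransversal B₁ γ₁) (h₂ : IsReebTransversal B₂ γ₂) (h₁0 : leaf (γ₁ 0) = 0)
    (h₂0 : leaf (γ₂ 0) = 0) : Tendsto (fun x : ℝ≥0 => φ (f x) (γ₁ x)) (𝓝[>] 0) (𝓝 (γ₂ 0)) := by
  let e : ℝ≥0 ≃o ℝ≥0 :=
    (h₂.strictMono_leaf h₂0).orderIsoOfSurjective _ (h₂.surjective_leaf h₂0)
  have h_end : Continuous fun x => γ₂ (e.symm (leaf (γ₁ x))) :=
    h₂.continuous.comp (e.symm.continuous.comp (continuous_leaf.comp h₁.continuous))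
  have h_start : γ₂ (e.symm (leaf (γ₁ 0))) = γ₂ 0 := by rw [h₁0, ← bot_eq_zero, e.symm.map_bot]
  refine ((h_end.tendsto' 0 _ h_start).mono_left nhdsWithin_le_nhds).congr' ?_
  filter_upwards [eventually_mem_nhdsWithin] with x hx
  obtain ⟨y, hy⟩ := (hf x hx (f x)).2 rfl
  have h_orbit : γ₂ y ∈ standardReebFlow.orbit (γ₁ x) := by
    rw [← hφ.orbit_eq, Flow.mem_orbit_iff]
    exact ⟨f x, hy.symm⟩
  rw [← hy, ← leaf_eq_of_mem_orbit h_orbit]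
  exact congrArg γ₂ (e.symm_apply_apply y)

theorem IsReebFlow.leaf_eq_of_semiconj {φ : Flow ℝ ReebPlane} (hφ : IsReebFlow φ)
    {h : ReebPlane → ReebPlane} (h_inj : Function.Injective h)
    (h_semiconj : ∀ t, Function.Semiconj h (φ t) (standardReebFlow t)) {p q : ReebPlane}
    (hp : leaf (h p) ≠ 0) (hpq : leaf (h q) = leaf (h p)) : leaf q = leaf p := by
  obtain ⟨t, ht⟩ := (Flow.mem_orbit_iff _).1 (mem_orbit_of_leaf_eq (mem_inner_iff.2 hp) hpq)
  apply leaf_eq_of_mem_orbit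
  rw [← hφ.orbit_eq, Flow.mem_orbit_iff]
  exact ⟨t, h_inj ((h_semiconj t p).trans ht)⟩

theorem exists_strictMonoOn_Icc_zero {g : ℝ≥0 → ℝ≥0} (hg : Continuous g) (h0 : g 0 = 0)
    (h_ne : ∀ᶠ x in 𝓝[>] 0, g x ≠ 0) (h_inj : ∀ x y, g x ≠ 0 → g y = g x → x = y) :
    ∃ δ, 0 < δ ∧ StrictMonoOn g (Icc 0 δ) := by
  obtain ⟨d, hd, h_ne⟩ := (nhdsGT_basis (0 : ℝ≥0)).eventually_iff.1 h_ne
  obtain ⟨δ, hδ, hδd⟩ := exists_between hd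
  refine ⟨δ, hδ, hg.continuousOn.strictMonoOn_of_injOn_Icc hδ.le (h0.trans_le zero_le) ?_⟩
  intro x hx y hy hxy
  rcases eq_or_ne x 0 with rfl | hx0
  · by_contra hy0
    exact h_ne ⟨pos_iff_ne_zero.2 (Ne.symm hy0), hy.2.trans_lt hδd⟩ (hxy.symm.trans h0)
  · exact h_inj x y (h_ne ⟨pos_iff_ne_zero.2 hx0, hx.2.trans_lt hδd⟩) hxy.symm

theorem reebSigma_nonpos_of_isConjugate_standardReebFlow {φ : Flow ℝ ReebPlane}
    {γ₁ γ₂ : ℝ≥0 → ReebPlane} {f : ℝ → ℝ} (hφ : IsReebFlow φ) (h₁ : IsReebTransversal xiZero γ₁)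
    (h₂ : IsReebTransversal etaZero γ₂) (hf : IsTransitTime φ γ₁ γ₂ f) (hfE : f ∈ reebE)
    (h_conj : φ.IsConjugate standardReebFlow) : reebSigma f ≤ 0 := by
  obtain ⟨h, -, -, h_semiconj⟩ := h_conj
  have h_leaf := leaf_eq_zero_of_mem_xiZero h₁.start
  have h_time := tendsto_comp_coe_of_mem_reebE hfE
  have h_cont : Continuous fun x => h (γ₁ x) := h.continuous.comp h₁.continuous
  have h_left : Tendsto (fun x => h (γ₁ x)) (𝓝[>] 0) (𝓝 (h (γ₁ 0))) :=
    (h_cont.tendsto 0).mono_left nhdsWithin_le_nhds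
  have h_right : Tendsto (fun x : ℝ≥0 => standardReebFlow (f x) (h (γ₁ x))) (𝓝[>] 0)
      (𝓝 (h (γ₂ 0))) :=
    ((h.continuous.tendsto _).comp (hf.tendsto hφ h₁ h₂ h_leaf
      (leaf_eq_zero_of_mem_etaZero h₂.start))).congr fun x => h_semiconj (f x) (γ₁ x)
  obtain ⟨δ, hδ, h_mono⟩ := exists_strictMonoOn_Icc_zero (continuous_leaf.comp h_cont)
    (leaf_eq_zero_of_mem_xiZero (mem_xiZero_of_tendsto_standardReebFlow h_time h_left h_right))
    (eventually_leaf_ne_zero h_time h_left h_right) fun x y hx hxy =>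
      h₁.injective_leaf h_leaf
        (hφ.leaf_eq_of_semiconj h.injective h_semiconj hx hxy).symm
  exact reebSigma_nonpos_of_tendsto_add_log hfE hδ h_mono
    (tendsto_add_log_leaf h_time h_left h_right)

end Conjugacy

theorem reebExample_one : reebExample 1 = 1 := by simp [reebExample]

theorem reebExample_two_rpow_quarter :
    reebExample ((2 : ℝ) ^ (1 / 4 : ℝ)) = 2 ^ (3 / 4 : ℝ) := by
  have h_angle : 2 * Real.pi * (1 / 4) = Real.pi / 2 := by ring
  rw [reebExample, Real.logb_rpow two_pos one_lt_two.ne', h_angle, Real.sin_pi_div_two,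
    ← Real.rpow_neg two_pos.le, ← Real.rpow_add two_pos]
  norm_num

theorem reebExample_div_two {x : ℝ} (hx : 0 < x) : reebExample (x / 2) = 2 * reebExample x := by
  have h_logb : Real.logb 2 (x / 2) = Real.logb 2 x - 1 := by
    rw [Real.logb_div hx.ne' two_ne_zero, Real.logb_self_eq_one one_lt_two]
  rw [reebExample, h_logb, mul_sub, mul_one, Real.sin_sub_two_pi, inv_div, div_eq_mul_inv,
    mul_assoc, reebExample]

theorem continuousOn_reebExample : ContinuousOn reebExample (Ioi 0) := by
  have h_ne (x : ℝ) (hx : x ∈ Ioi 0) : x ≠ 0 := ne_of_gt hx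
  have h_logb : ContinuousOn (Real.logb 2) (Ioi 0) :=
    (Real.continuousOn_log.mono h_ne).div_const _
  exact (continuousOn_inv₀.mono h_ne).mul (continuousOn_const.rpow
    (Real.continuous_sin.comp_continuousOn (h_logb.const_mul _)) fun _ _ => Or.inl two_ne_zero)

theorem inv_mul_half_le_reebExample {x : ℝ} (hx : 0 < x) : x⁻¹ * 2⁻¹ ≤ reebExample x := by
  refine mul_le_mul_of_nonneg_left ?_ (inv_nonneg.2 hx.le)
  rw [← Real.rpow_neg_one]
  exact Real.rpow_le_rpow_of_exponent_le one_le_two (Real.neg_one_le_sin _)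

theorem reebExample_mem_reebE : reebExample ∈ reebE :=
  ⟨continuousOn_reebExample, tendsto_atTop_mono' _
    (eventually_mem_nhdsWithin.mono fun _ hx => inv_mul_half_le_reebExample hx)
    (tendsto_inv_nhdsGT_zero.atTop_mul_const (inv_pos.2 two_pos))⟩

theorem reebSigma_reebExample : reebSigma reebExample = ⊤ := by
  refine reebSigma_eq_top_of_apply_div continuousOn_reebExample one_lt_two one_lt_two
    (fun _ => reebExample_div_two) one_pos
    (Real.one_lt_rpow one_lt_two (by norm_num : (0 : ℝ) < 1 / 4)) ?_
  rw [reebExample_one, reebExample_two_rpow_quarter]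
  exact Real.one_lt_rpow one_lt_two (by norm_num)

theorem mainTheorem3 :
    reebExample ∈ reebE ∧
    (∀ x : ℝ, 0 < x → reebExample (x / 2) = 2 * reebExample x) ∧
    reebSigma reebExample = ⊤ ∧
    ∃ φ : Flow ℝ ReebPlane,
      IsReebFlow φ ∧
      (∃ γ₁ γ₂ : ℝ≥0 → ReebPlane,
        IsReebTransversal ReebPlane.xiZero γ₁ ∧
        IsReebTransversal ReebPlane.etaZero γ₂ ∧
        IsTransitTime φ γ₁ γ₂ reebExample) ∧
      ¬ φ.IsConjugate standardReebFlow ∧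
      (φ.rescale 2).IsConjugate φ := by
  have hf := reebExample_mem_reebE
  have hφ := ReebPlane.isReebFlow_reebFlow hf
  have h₁ := ReebPlane.isReebTransversal_leftPoint hf
  have h₂ := ReebPlane.isReebTransversal_swap_leftPoint hf
  have h_transit := ReebPlane.isTransitTime_reebFlow hf
  refine ⟨hf, fun _ => reebExample_div_two, reebSigma_reebExample, ReebPlane.reebFlow hf, hφ,
    ⟨_, _, h₁, h₂, h_transit⟩, fun h_conj => ?_, ?_⟩
  · have h_nonpos := reebSigma_nonpos_of_isConjugate_standardReebFlow hφ h₁ h₂ h_transit hf h_conj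
    exact EReal.top_ne_zero (le_antisymm (reebSigma_reebExample ▸ h_nonpos) le_top)
  · exact ReebPlane.isConjugate_rescale_reebFlow hf (l := 2) two_ne_zero two_ne_zero
      fun _ => reebExample_div_two
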